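/- Let $\mathfrak{g}^c$ be a finite-dimensional complex semisimple Lie algebra with canonical generators $h_i,x_i,y_i$ ($1\le i\le \ell$), i.e. generators with $[h_i,h_j]=0$, $[h_i,x_j]=\langle\alpha_j,\alpha_i^\vee\rangle x_j$, $[h_i,y_j]=-\langle\alpha_j,\alpha_i^\vee\rangle y_j$, $[x_i,y_j]=\delta_{ij}h_i$, where the $h_i$ form a basis of a Cartan subalgebra $\mathfrak{h}^c$ and $\alpha_1,\dots,\alpha_\ell$ are the corresponding simple roots. Let $\rho:\mathfrak{g}^c\to\mathfrak{gl}(V^c)$ be a finite-dimensional representation. A highest weight vector of weight $\mu\in(\mathfrak{h}^c)^*$ is a vector $v$ with $\rho(h)v=\mu(h)v$ for all $h\in\mathfrak{h}^c$ and $\rho(x_i)v=0$ for all $i$; $\mu$ is a highest weight of $\rho$ if there is such a $v\neq 0$. Let $\lambda_1,\dots,\lambda_r$ be the distinct highest weights of $\rho$ and, for each $j$, let $v_{j,1},\dots,v_{j,m_j}$ be a basis of the space of highest weight vectors of weight $\lambda_j$. Let $V(\lambda_j,l)$ be the $\mathfrak{g}^c$-submodule of $V^c$ generated by $v_{j,l}$.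 For each $j$ fix a set $S_{\lambda_j}$ of finite (possibly empty) sequences $(i_1,\dots,i_k)$ of elements of $\{1,\dots,\ell\}$ such that, in a finite-dimensional irreducible $\mathfrak{g}^c$-module of highest weight $\lambda_j$ with nonzero highest weight vector $w$, the elements $y_{i_1}\cdots y_{i_k}w$, $(i_1,\dots,i_k)\in S_{\lambda_j}$, form a basis. Then each $V(\lambda_j,l)$ is irreducible, $V^c$ is the direct sum of the $V(\lambda_j,l)$ ($1\le j\le r$, $1\le l\le m_j$), and the elements $\rho(y_{i_1})\cdots\rho(y_{i_k})v_{j,l}$ with $1\le j\le r$, $1\le l\le m_j$, $(i_1,\dots,i_k)\in S_{\lambda_j}$ form a basis of $V^c$. For $1\le j\le r$ and $1\le s,t\le m_j$ let $A_j^{s,t}:V^c\to V^c$ be the linear map that sends $\rho(y_{i_1})\cdots\rho(y_{i_k})v_{j,s}$ to $\rho(y_{i_1})\cdots\rho(y_{i_k})v_{j,t}$ for $(i_1,\dots,i_k)\in S_{\lambda_j}$ and all other elements of this basis to $0$. Then $A_j^{s,t}$ maps $V(\lambda_j,s)$ bijectively onto $V(\lambda_j,t)$ and vanishes on every other summand $V(\lambda_k,u)$,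 $(k,u)\neq(j,s)$. The maps $A_j^{s,t}$ ($1\le j\le r$, $1\le s,t\le m_j$) form a basis of $$\mathrm{End}_\rho(V^c)=\{A\in\mathrm{End}(V^c)\mid A\rho(x)=\rho(x)A\text{ for all }x\in\mathfrak{g}^c\}.$$ -/

import Mathlib

universe u

namespace HighestWeight

/-- The space of all `v` in `V` with `h v = μ(h) v` for `h` in the Cartan subalgebra and `x_i v = 0`
for all `i`. Its elements are the highest weight vectors of weight `μ` (together with zero). -/
def hwSpace {g : Type*} [LieRing g] [LieAlgebra ℂ g] {H : LieSubalgebra ℂ g} {ℓ : ℕ}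
    (b : LieAlgebra.Basis (Fin ℓ) H)
    (V : Type*) [AddCommGroup V] [Module ℂ V] [LieRingModule g V] [LieModule ℂ g V]
    (μ : Module.Dual ℂ H) : Submodule ℂ V where
  carrier := {v | (∀ h : H, ⁅(h : g), v⁆ = μ h • v) ∧ ∀ i, ⁅b.e i, v⁆ = 0}
  zero_mem' := by simp
  add_mem' := by
    rintro v w ⟨hv, hv'⟩ ⟨hw, hw'⟩
    exact ⟨fun h => by rw [lie_add, hv, hw, smul_add], fun i => by rw [lie_add, hv', hw', add_zero]⟩
  smul_mem' := by
    rintro c v ⟨hv, hv'⟩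
    exact ⟨fun h => by rw [lie_smul, hv, smul_comm], fun i => by rw [lie_smul, hv', smul_zero]⟩

/-- `μ` is a highest weight of `V`. -/
def IsHighestWeight {g : Type*} [LieRing g] [LieAlgebra ℂ g] {H : LieSubalgebra ℂ g} {ℓ : ℕ}
    (b : LieAlgebra.Basis (Fin ℓ) H)
    (V : Type*) [AddCommGroup V] [Module ℂ V] [LieRingModule g V] [LieModule ℂ g V]
    (μ : Module.Dual ℂ H) : Prop :=
  ∃ v ∈ hwSpace b V μ, v ≠ 0

/-- `lowering b [i₁, …, i_k] v = y_{i₁} (⋯ (y_{i_k} v))`. -/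
def lowering {g : Type*} [LieRing g] [LieAlgebra ℂ g] {H : LieSubalgebra ℂ g} {ℓ : ℕ}
    (b : LieAlgebra.Basis (Fin ℓ) H)
    {V : Type*} [AddCommGroup V] [Module ℂ V] [LieRingModule g V] [LieModule ℂ g V]
    (I : List (Fin ℓ)) (v : V) : V :=
  I.foldr (fun i w => ⁅b.f i, w⁆) v

/-- `S` is an admissible set of index sequences for the highest weight `μ`: in some
finite-dimensional irreducible module `W` with nonzero highest weight vector `w` of weight `μ`, the
`y_{i₁} ⋯ y_{i_k} w` with `(i₁, …, i_k) ∈ S` form a basis of `W`. -/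
def IsMonomialIndexSet {g : Type*} [LieRing g] [LieAlgebra ℂ g] {H : LieSubalgebra ℂ g} {ℓ : ℕ}
    (b : LieAlgebra.Basis (Fin ℓ) H) (μ : Module.Dual ℂ H) (S : Set (List (Fin ℓ))) : Prop :=
  ∃ (W : Type u) (_ : AddCommGroup W) (_ : Module ℂ W) (_ : LieRingModule g W)
    (_ : LieModule ℂ g W), FiniteDimensional ℂ W ∧ LieModule.IsIrreducible ℂ g W ∧
    ∃ w ∈ hwSpace b W μ, w ≠ 0 ∧
      LinearIndependent ℂ (fun I : S => lowering b I.1 w) ∧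
      Submodule.span ℂ (Set.range fun I : S => lowering b I.1 w) = ⊤

/-- The submodule generated by `v`. -/
def cyclic (g : Type*) [LieRing g] [LieAlgebra ℂ g]
    {V : Type*} [AddCommGroup V] [Module ℂ V] [LieRingModule g V] [LieModule ℂ g V]
    (v : V) : LieSubmodule ℂ g V :=
  LieSubmodule.lieSpan ℂ g {v}

/-- The linear map `A_j^{s,t}`: given a basis `B` of `V` whose `((k, u), I)`-th element is `y_I v_{k,u}`,
it sends `y_I v_{j,s}` to `y_I v_{j,t}` and all other basis elements to zero. -/
noncomputable def transition {g : Type*} [LieRing g] [LieAlgebra ℂ g] {H : LieSubalgebra ℂ g}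
    {ℓ : ℕ} (b : LieAlgebra.Basis (Fin ℓ) H)
    {V : Type*} [AddCommGroup V] [Module ℂ V] [LieRingModule g V] [LieModule ℂ g V]
    {r : ℕ} {m : Fin r → ℕ} {S : Fin r → Set (List (Fin ℓ))}
    (v : (j : Fin r) → Fin (m j) → V)
    (B : Module.Basis (Σ p : (Σ j : Fin r, Fin (m j)), S p.1) ℂ V)
    (j : Fin r) (s t : Fin (m j)) : Module.End ℂ V :=
  B.constr ℂ fun q => if q.1 = ⟨j, s⟩ then lowering b q.2.1 (v j t) else 0

/-- The space of linear endomorphisms of `V` commuting with the action of `g`. -/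
def commutant (g : Type*) [LieRing g] [LieAlgebra ℂ g]
    (V : Type*) [AddCommGroup V] [Module ℂ V] [LieRingModule g V] [LieModule ℂ g V] :
    Submodule ℂ (Module.End ℂ V) :=
  Subalgebra.toSubmodule
    (Subalgebra.centralizer ℂ (Set.range fun x : g => LieModule.toEnd ℂ g V x))

end HighestWeight

/-! By Weyl's theorem, `V` is completely reducible. A highest weight vector therefore generates an
irreducible submodule, and the submodule generated by all highest weight vectors has a complement
without such vectors, so it is everything. Taking a basis of each space of highest weight vectors
makes the sum of the cyclic modules direct.

Two highest weight vectors of equal weight generate isomorphic modules, by an isomorphism that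
matches the monomials in the `y_i`. Hence a set `S` tested on one irreducible model gives bases of
all the summands, and `A_j^{s,t}`, defined on basis monomials only, is on `V(λ_j, s)` the module
isomorphism with `v_{j,s} ↦ v_{j,t}`. So it commutes with `g`. Conversely, an element of the
commutant preserves each space of highest weight vectors and is determined by its values on the
`v_{j,s}`; the matrices of these values are the coordinates with respect to the `A_j^{s,t}`.

Semisimplicity enters as nondegeneracy of the Killing form. It yields Whitehead's first lemma
through a Casimir operator, and from it Weyl's theorem (`complementedLattice_of_isKilling`). The
other main lemmas are `isIrreducible_of_cyclic_eq_top`, `exists_equiv_cyclic`, `iSupIndep_cyclic`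
and `exists_transition_eq_equiv`. -/

namespace LieModule

open LieAlgebra Module

/-! ### Whitehead's first lemma and Weyl's theorem -/

section Whitehead

variable {k L : Type*} [Field k] [LieRing L] [LieAlgebra k L]

/-- The tensor `∑ x i ⊗ x' i` is invariant because `y` acts on the two families by a matrix and its
negative transpose; `T` is an arbitrary bilinear map applied to it. It serves for the Casimir
operator and again for the cocycle computation. -/
lemma sum_lie_add_lie_eq_zero {ι N : Type*} [Fintype ι] [AddCommGroup N] [Module k N]
    (T : L →ₗ[k] L →ₗ[k] N) {x x' : ι → L} {y : L} {a : ι → ι → k}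
    (hx : ∀ i, ⁅y, x i⁆ = ∑ j, a i j • x j) (hx' : ∀ i, ⁅y, x' i⁆ = -∑ j, a j i • x' j) :
    ∑ i, (T ⁅y, x i⁆ (x' i) + T (x i) ⁅y, x' i⁆) = 0 := by
  simp only [hx, hx', map_sum, map_neg, map_smul, LinearMap.sum_apply, LinearMap.smul_apply,
    Finset.sum_add_distrib, Finset.sum_neg_distrib]
  rw [Finset.sum_comm, add_neg_cancel]

variable [FiniteDimensional k L]

/-- Dual bases with respect to an invariant symmetric form that is non-degenerate on an ideal
transform contragrediently under the adjoint action. -/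
lemma exists_invariant_dual_families (Φ : LinearMap.BilinForm k L)
    (hsymm : ∀ x y, Φ x y = Φ y x) (hinv : ∀ x y z, Φ ⁅x, y⁆ z = Φ x ⁅y, z⁆)
    (I : LieIdeal k L) (hI : ∀ x ∈ I, (∀ y ∈ I, Φ x y = 0) → x = 0) :
    ∃ x : Fin (finrank k I) → L, ∃ x' : Fin (finrank k I) → L,
      (∀ i, Φ (x i) (x' i) = 1) ∧
      ∀ y : L, ∃ a : Fin (finrank k I) → Fin (finrank k I) → k,
        (∀ i, ⁅y, x i⁆ = ∑ j, a i j • x j) ∧ ∀ i, ⁅y, x' i⁆ = -∑ j, a j i • x' j := by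
  let Ψ : LinearMap.BilinForm k I := Φ.restrict I.toSubmodule
  have hΨ (x y : I) : Ψ x y = Φ x y := rfl
  have hsymm' : Ψ.IsSymm := ⟨fun x y => hsymm x y⟩
  have hnd : Ψ.Nondegenerate := by
    refine hsymm'.isRefl.nondegenerate_iff_separatingLeft.mpr ?_
    intro x hx
    exact Subtype.ext (hI x x.2 fun y hy => hx ⟨y, hy⟩)
  let b := Module.finBasis k I
  let b' := Ψ.dualBasis hnd b
  have hbb' (i j) : Ψ (b i) (b' j) = if i = j then 1 else 0 :=
    LinearMap.BilinForm.apply_dualBasis_right hnd hsymm' b i j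
  have hexp (z : I) : z = ∑ j, Ψ z (b' j) • b j := by
    conv_lhs => rw [← b.sum_repr z]
    refine Finset.sum_congr rfl fun j _ => ?_
    congr 1
    conv_rhs => rw [← b.sum_repr z]
    simp only [map_sum, map_smul, LinearMap.sum_apply, LinearMap.smul_apply, hbb']
    simp
  have hexp' (z : I) : z = ∑ j, Ψ z (b j) • b' j := by
    conv_lhs => rw [← b'.sum_repr z]
    simp_rw [b', LinearMap.BilinForm.dualBasis_repr_apply]
  refine ⟨fun i => b i, fun i => b' i, fun i => by rw [← hΨ, hbb', if_pos rfl], fun y => ?_⟩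
  -- The matrix is read off by pairing with the dual basis; invariance and symmetry of `Φ` turn the
  -- coefficients of `⁅y, x' i⁆` into its negative transpose.
  refine ⟨fun i j => Φ ⁅y, (b i : L)⁆ (b' j), fun i => ?_, fun i => ?_⟩
  · have := congrArg (Subtype.val) (hexp ⟨⁅y, (b i : L)⁆, I.lie_mem (b i).2⟩)
    simpa [hΨ] using this
  · have := congrArg (Subtype.val) (hexp' ⟨⁅y, (b' i : L)⁆, I.lie_mem (b' i).2⟩)
    rw [← Finset.sum_neg_distrib]
    simp only [hΨ, AddSubmonoidClass.coe_finsetSum, SetLike.val_smul] at this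
    rw [this]
    refine Finset.sum_congr rfl fun j _ => ?_
    change _ = -(Φ ⁅y, (b j : L)⁆ (b' i) • (b' j : L))
    rw [← neg_smul, ← lie_skew, map_neg, LinearMap.neg_apply, hinv, hsymm (b' i : L)]

variable [IsKilling k L]

variable (k L) in
-- The bracket of the Killing complement of `[L, L]` with itself lies in both ideals, so the
-- complement is abelian and hence zero.
lemma derivedSeries_one_eq_top_of_isKilling : derivedSeries k L 1 = ⊤ := by
  set D : LieIdeal k L := derivedSeries k L 1 with hD
  have hc := LieIdeal.isCompl_killingCompl (K := k) (L := L) D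
  have : IsLieAbelian D.killingCompl := by
    rw [LieSubmodule.lie_abelian_iff_lie_self_eq_bot, eq_bot_iff, ← hc.disjoint.eq_bot]
    refine le_inf ?_ (LieSubmodule.lie_le_right _ _)
    rw [hD, derivedSeries_def, derivedSeriesOfIdeal_succ, derivedSeriesOfIdeal_zero]
    exact LieSubmodule.mono_lie le_top le_top
  have h0 := IsKilling.ideal_eq_bot_of_isLieAbelian D.killingCompl
  simpa [h0] using hc.sup_eq_top

variable {M : Type*} [AddCommGroup M] [Module k M] [LieRingModule L M] [LieModule k L M]

lemma derivation_eq_zero_of_trivial (D : LieDerivation k L M) (hM : ∀ (x : L) (m : M), ⁅x, m⁆ = 0) :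
    D = 0 := by
  have key : (derivedSeries k L 1).toSubmodule ≤ LinearMap.ker (D : L →ₗ[k] M) := by
    rw [derivedSeries_def, derivedSeriesOfIdeal_succ, derivedSeriesOfIdeal_zero,
      LieSubmodule.lieIdeal_oper_eq_linear_span', Submodule.span_le]
    rintro _ ⟨x, -, y, -, rfl⟩
    simp [hM]
  rw [derivedSeries_one_eq_top_of_isKilling] at key
  ext x
  exact key (Submodule.mem_top (x := x))

variable [CharZero k] [FiniteDimensional k M]

/-- Whitehead's first lemma for irreducible modules. -/
lemma exists_eq_lie_of_derivation_of_isIrreducible [IsIrreducible k L M]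
    (D : LieDerivation k L M) : ∃ m : M, ∀ x, D x = ⁅x, m⁆ := by
  have : Nontrivial M := nontrivial_of_isIrreducible k L M
  let Φ := traceForm k L M
  -- The trace form of `M` may be degenerate. Its radical `K` is an ideal, and the form is
  -- nondegenerate on the Killing complement `I`, since `L = K + I` and `K` is orthogonal to all of
  -- `L`.
  let K : LieIdeal k L :=
    { LinearMap.ker Φ with
      lie_mem := by
        intro x y hy
        change Φ ⁅x, y⁆ = 0
        replace hy : Φ y = 0 := hy
        ext z
        rw [traceForm_comm, ← traceForm_apply_lie_apply, traceForm_comm]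
        exact LinearMap.congr_fun hy _ }
  have hK (x : L) : x ∈ K ↔ Φ x = 0 := Iff.rfl
  have hcompl := LieIdeal.isCompl_killingCompl K
  set I := K.killingCompl
  obtain ⟨x, x', hxx', hy⟩ := exists_invariant_dual_families Φ (traceForm_comm k L M)
    (traceForm_apply_lie_apply k L M) I (by
      intro x hx hxy
      have hxK : x ∈ K := by
        rw [hK]
        ext z
        obtain ⟨u, hu, w, hw, rfl⟩ := (LieSubmodule.mem_sup _ _ z).mp
          (hcompl.sup_eq_top ▸ LieSubmodule.mem_top z)
        have hu' : Φ u x = 0 := by rw [(hK u).mp hu]; rfl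
        rw [map_add, traceForm_comm, hu', hxy w hw, add_zero, LinearMap.zero_apply]
      have := (LieSubmodule.mem_inf (N := K) (N' := I) x).mpr ⟨hxK, hx⟩
      rwa [hcompl.inf_eq_bot, LieSubmodule.mem_bot] at this)
  by_cases hI : finrank k I = 0
  · have hI' : I = ⊥ := by
      rw [← LieSubmodule.toSubmodule_eq_bot]
      exact Submodule.finrank_eq_zero.mp hI
    have hKtop : K = ⊤ := by simpa [hI'] using hcompl.sup_eq_top
    -- With zero trace form, `L = [L, L]` acts nilpotently, so the irreducible module `M` is
    -- trivial.
    have hΦ : traceForm k L M = 0 := by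
      refine LinearMap.ext fun z => ?_
      exact (hK z).mp (hKtop ▸ LieSubmodule.mem_top z)
    have hnil := isNilpotent_derivedSeries_of_traceForm_eq_zero hΦ
    have hnil' : IsNilpotent L M := by
      rw [isNilpotent_iff_forall' (R := k)] at hnil ⊢
      exact fun z => hnil ⟨z, by
        rw [derivedSeries_one_eq_top_of_isKilling]; exact LieSubmodule.mem_top z⟩
    have htriv := nontrivial_max_triv_of_isNilpotent k L M
    have htop := (maxTrivSubmodule k L M).eq_top_of_isIrreducible
    have hM (z : L) (m : M) : ⁅z, m⁆ = 0 :=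
      (mem_maxTrivSubmodule k L M m).mp (htop ▸ LieSubmodule.mem_top m) z
    exact ⟨0, fun z => by rw [derivation_eq_zero_of_trivial D hM]; simp⟩
  -- The Casimir operator of the trace form on `I`. It commutes with `L` and has trace `dim I ≠ 0`,
  -- so its kernel is a proper submodule of an irreducible module, and `Γ` is bijective.
  · let Γ : End k M := ∑ i, toEnd k L M (x i) * toEnd k L M (x' i)
    have hΓ (m : M) : Γ m = ∑ i, ⁅x i, ⁅x' i, m⁆⁆ := by simp [Γ, LinearMap.sum_apply]
    have htr : LinearMap.trace k M Γ = finrank k I := by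
      simp only [Γ, map_sum]
      trans ∑ i, Φ (x i) (x' i)
      · rfl
      · simp [hxx']
    have hcomm (y : L) (m : M) : ⁅y, Γ m⁆ = Γ ⁅y, m⁆ := by
      obtain ⟨a, ha, ha'⟩ := hy y
      have h0 := sum_lie_add_lie_eq_zero
        (LinearMap.mk₂ k (fun u w : L => ⁅u, ⁅w, m⁆⁆) (by simp) (by simp) (by simp) (by simp)) ha ha'
      simp only [LinearMap.mk₂_apply] at h0
      rw [← sub_eq_zero, hΓ, hΓ, lie_sum, ← Finset.sum_sub_distrib, ← h0]
      refine Finset.sum_congr rfl fun i _ => ?_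
      rw [lie_lie, lie_lie, lie_sub]
      abel
    let N : LieSubmodule k L M :=
      { LinearMap.ker Γ with
        lie_mem := by
          intro y m hm
          change Γ ⁅y, m⁆ = 0
          rw [← hcomm, show Γ m = 0 from hm, lie_zero] }
    have hN : LinearMap.ker Γ = ⊥ := by
      rcases eq_bot_or_eq_top N with h | h
      · exact (LieSubmodule.toSubmodule_eq_bot N).mpr h
      · have : Γ = 0 := by
          ext m
          exact (h ▸ LieSubmodule.mem_top m : m ∈ N)
        rw [this, map_zero] at htr
        exact absurd (by exact_mod_cast htr.symm) hI
    -- The choice `Γ m = ∑ x i · D (x' i)` works because invariance of the dual families and the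
    -- Leibniz rule give `y · Γ m = Γ (D y)`, and `Γ` can be cancelled.
    obtain ⟨m, hm⟩ := LinearMap.surjective_of_injective (LinearMap.ker_eq_bot.mp hN)
      (∑ i, ⁅x i, D (x' i)⁆)
    refine ⟨m, fun y => LinearMap.ker_eq_bot.mp hN ?_⟩
    rw [← hcomm, hm, hΓ, lie_sum]
    obtain ⟨a, ha, ha'⟩ := hy y
    have h0 := sum_lie_add_lie_eq_zero
      (LinearMap.mk₂ k (fun u w : L => ⁅u, D w⁆) (by simp) (by simp) (by simp) (by simp)) ha ha'
    simp only [LinearMap.mk₂_apply] at h0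
    rw [eq_comm, ← sub_eq_zero, ← Finset.sum_sub_distrib, ← h0]
    refine Finset.sum_congr rfl fun i _ => ?_
    rw [LieDerivation.apply_lie_eq_sub, lie_lie, lie_sub]
    abel

omit [FiniteDimensional k M] in
-- Induction on dimension along a proper nonzero submodule `N`: the derivation is inner modulo `N`,
-- and subtracting the inner derivation of a lift leaves one with values in `N`.
lemma exists_eq_lie_of_derivation_aux (n : ℕ) :
    ∀ (M : Type*) [AddCommGroup M] [Module k M] [LieRingModule L M] [LieModule k L M]
      [FiniteDimensional k M], finrank k M = n →
      ∀ D : LieDerivation k L M, ∃ m : M, ∀ x, D x = ⁅x, m⁆ := by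
  induction n using Nat.strong_induction_on with
  | _ n ih =>
  intro M _ _ _ _ _ hn D
  rcases subsingleton_or_nontrivial M with hM | hM
  · exact ⟨0, fun x => Subsingleton.elim _ _⟩
  by_cases hirr : ∀ N : LieSubmodule k L M, N ≠ ⊥ → N = ⊤
  · have := IsIrreducible.mk hirr
    exact exists_eq_lie_of_derivation_of_isIrreducible D
  push Not at hirr
  obtain ⟨N, hbot, htop⟩ := hirr
  have hbot' : 0 < finrank k N.toSubmodule := by
    rw [Nat.pos_iff_ne_zero, ne_eq, Submodule.finrank_eq_zero, LieSubmodule.toSubmodule_eq_bot]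
    exact hbot
  have hlt : finrank k N.toSubmodule < finrank k M :=
    Submodule.finrank_lt (by simpa using htop)
  have hq := Submodule.finrank_quotient_add_finrank N.toSubmodule
  let D₁ : LieDerivation k L (M ⧸ N) :=
    { toLinearMap := (LieSubmodule.Quotient.mk' N : M →ₗ[k] M ⧸ N) ∘ₗ (D : L →ₗ[k] M)
      leibniz' := by
        intro x y
        simp only [LinearMap.comp_apply, LieDerivation.coeFn_coe,
          LieDerivation.apply_lie_eq_sub, map_sub]
        rfl }
  obtain ⟨m₁, hm₁⟩ := ih (finrank k (M ⧸ N)) (by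
    change finrank k (M ⧸ N.toSubmodule) < n
    omega) (M ⧸ N) rfl D₁
  obtain ⟨m, rfl⟩ := LieSubmodule.Quotient.surjective_mk' N m₁
  have hmem (x : L) : D x - ⁅x, m⁆ ∈ N := by
    rw [← LieSubmodule.Quotient.mk_eq_zero, map_sub, LieModuleHom.map_lie, sub_eq_zero]
    exact hm₁ x
  let D₂ : LieDerivation k L N :=
    { toLinearMap := LinearMap.codRestrict N.toSubmodule
        ((D : L →ₗ[k] M) - (toEnd k L M : L →ₗ[k] End k M).flip m) hmem
      leibniz' := by
        intro x y
        apply Subtype.ext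
        change D ⁅x, y⁆ - ⁅⁅x, y⁆, m⁆ = ⁅x, D y - ⁅y, m⁆⁆ - ⁅y, D x - ⁅x, m⁆⁆
        rw [LieDerivation.apply_lie_eq_sub, lie_lie, lie_sub, lie_sub]
        abel }
  obtain ⟨m₂, hm₂⟩ := ih (finrank k N) (by
    change finrank k N.toSubmodule < n
    omega) N rfl D₂
  refine ⟨m + m₂, fun x => ?_⟩
  have := congrArg Subtype.val (hm₂ x)
  rw [lie_add, ← sub_eq_iff_eq_add']
  exact this

/-- Whitehead's first lemma: every derivation with values in a finite-dimensional module is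
inner. -/
lemma exists_eq_lie_of_derivation (D : LieDerivation k L M) : ∃ m : M, ∀ x, D x = ⁅x, m⁆ :=
  exists_eq_lie_of_derivation_aux _ M rfl D

variable (k L M) in
/-- Weyl's theorem on complete reducibility. -/
theorem complementedLattice_of_isKilling : ComplementedLattice (LieSubmodule k L M) := by
  refine ⟨fun W => ?_⟩
  obtain ⟨p, hp⟩ := W.toSubmodule.subtype.exists_leftInverse_of_injective W.toSubmodule.ker_subtype
  replace hp (w : W) : p w = w := LinearMap.congr_fun hp w
  let p' : M →ₗ[k] W := p
  have hp' (w : W) : p' w = w := hp w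
  -- The maps vanishing on `W`. Since `p'` is the identity on `W`, `x ↦ ⁅x, p'⁆` is a derivation
  -- into `N`. It is inner by Whitehead, given by some `φ ∈ N`, and `p' - φ` is an equivariant
  -- projection onto `W`, whose kernel is the complement.
  let N : LieSubmodule k L (M →ₗ[k] W) :=
    { carrier := {φ | ∀ w : W, φ w = 0}
      zero_mem' := fun w => rfl
      add_mem' := fun h h' w => by simp [h w, h' w]
      smul_mem' := fun c φ h w => by simp [h w]
      lie_mem := by
        intro x φ h w
        have := h ⁅x, w⁆
        rw [LieSubmodule.coe_bracket] at this
        rw [LieHom.lie_apply, h w, this]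
        simp }
  have hN (x : L) : ⁅x, p'⁆ ∈ N := by
    intro w
    have := hp' ⁅x, w⁆
    rw [LieSubmodule.coe_bracket] at this
    rw [LieHom.lie_apply, hp', this, sub_self]
  let D : LieDerivation k L N :=
    { toLinearMap := LinearMap.codRestrict N.toSubmodule
        ((toEnd k L (M →ₗ[k] W) : L →ₗ[k] End k (M →ₗ[k] W)).flip p') hN
      leibniz' := by
        intro x y
        apply Subtype.ext
        change ⁅⁅x, y⁆, p'⁆ = ⁅x, ⁅y, p'⁆⁆ - ⁅y, ⁅x, p'⁆⁆
        rw [lie_lie] }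
  obtain ⟨φ, hφ⟩ := exists_eq_lie_of_derivation D
  let q : M →ₗ[k] W := p' - φ
  have hq (w : W) : q w = w := by
    have : (φ : M →ₗ[k] W) w = 0 := φ.2 w
    simp [q, hp', this]
  have hqx (x : L) (m : M) : q ⁅x, m⁆ = ⁅x, q m⁆ := by
    have h1 : ⁅x, p'⁆ = ⁅x, (φ : M →ₗ[k] W)⁆ := congrArg Subtype.val (hφ x)
    have h2 : ⁅x, q⁆ = 0 := by rw [lie_sub, h1, sub_self]
    have h3 := LinearMap.congr_fun h2 m
    rw [LieHom.lie_apply, LinearMap.zero_apply, sub_eq_zero] at h3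
    exact h3.symm
  let C : LieSubmodule k L M :=
    { LinearMap.ker q with
      lie_mem := by
        intro x m hm
        change q ⁅x, m⁆ = 0
        rw [hqx, show q m = 0 from hm, lie_zero] }
  refine ⟨C, ?_⟩
  rw [← LieSubmodule.isCompl_toSubmodule]
  exact LinearMap.isCompl_of_proj (p := W.toSubmodule) (f := q) hq

end Whitehead

end LieModule

namespace HighestWeight

open LieModule LieAlgebra

/-! ### Highest weight vectors and the modules they generate -/

section Basic

variable {g : Type*} [LieRing g] [LieAlgebra ℂ g] {H : LieSubalgebra ℂ g} {ℓ : ℕ}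
  (b : LieAlgebra.Basis (Fin ℓ) H)
  {V : Type*} [AddCommGroup V] [Module ℂ V] [LieRingModule g V] [LieModule ℂ g V]
  {W : Type*} [AddCommGroup W] [Module ℂ W] [LieRingModule g W] [LieModule ℂ g W]

lemma lie_e_eq (h : H) (i : Fin ℓ) : ⁅(h : g), b.e i⁆ = b.baseSupp i h • b.e i :=
  (b.baseSupp_apply_smul_e i h).symm

lemma lie_f_eq (h : H) (i : Fin ℓ) : ⁅(h : g), b.f i⁆ = -(b.baseSupp i h • b.f i) := by
  rw [b.baseSupp_apply_smul_f i h, neg_neg]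
  rfl

/-- An element of the Cartan subalgebra on which every simple root takes the value one. -/
lemma exists_grading_element : ∃ h₀ : H, ∀ i, b.baseSupp i h₀ = 1 := by
  classical
  let A : Matrix (Fin ℓ) (Fin ℓ) ℂ := (Int.castRingHom ℂ).mapMatrix b.A
  have hdet : IsUnit A.det := by
    rw [isUnit_iff_ne_zero, ← RingHom.map_det]
    simpa using b.nondegen.det_ne_zero
  -- The coefficients solve `A c = 1` for the invertible Cartan matrix `A`.
  refine ⟨∑ j, (A⁻¹.mulVec 1) j • b.h' j, fun i => ?_⟩
  have h1 : A.mulVec (A⁻¹.mulVec 1) = 1 := by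
    rw [Matrix.mulVec_mulVec, Matrix.mul_nonsing_inv A hdet, Matrix.one_mulVec]
  have h2 := congrFun h1 i
  simp only [map_sum, map_smul, LieAlgebra.Basis.baseSupp_apply_h', smul_eq_mul]
  rw [Pi.one_apply, Matrix.mulVec, dotProduct] at h2
  rw [← h2]
  exact Finset.sum_congr rfl fun j _ => mul_comm _ _

variable {b}

lemma map_mem_hwSpace {μ : Module.Dual ℂ H} {v : V} (f : V →ₗ⁅ℂ,g⁆ W) (hv : v ∈ hwSpace b V μ) :
    f v ∈ hwSpace b W μ :=
  ⟨fun h => by rw [← f.map_lie, hv.1, map_smul], fun i => by rw [← f.map_lie, hv.2, map_zero]⟩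

lemma mem_hwSpace_of_map {μ : Module.Dual ℂ H} {v : V} (f : V →ₗ⁅ℂ,g⁆ W)
    (hf : Function.Injective f) (hv : f v ∈ hwSpace b W μ) : v ∈ hwSpace b V μ :=
  ⟨fun h => hf (by rw [f.map_lie, hv.1, map_smul]),
    fun i => hf (by rw [f.map_lie, hv.2, map_zero])⟩

@[simp] lemma lowering_nil (v : V) : lowering b [] v = v := rfl

lemma lowering_cons (i : Fin ℓ) (I : List (Fin ℓ)) (v : V) :
    lowering b (i :: I) v = ⁅b.f i, lowering b I v⁆ := rfl

lemma map_lowering (f : V →ₗ⁅ℂ,g⁆ W) (I : List (Fin ℓ)) (v : V) :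
    f (lowering b I v) = lowering b I (f v) := by
  induction I with
  | nil => rfl
  | cons i I ih => rw [lowering_cons, lowering_cons, f.map_lie, ih]

lemma lowering_mem (N : LieSubmodule ℂ g V) (I : List (Fin ℓ)) {v : V} (hv : v ∈ N) :
    lowering b I v ∈ N := by
  induction I with
  | nil => exact hv
  | cons i I ih => exact N.lie_mem ih

lemma self_mem_cyclic (v : V) : v ∈ cyclic g v :=
  LieSubmodule.subset_lieSpan rfl

lemma cyclic_le {v : V} {N : LieSubmodule ℂ g V} : cyclic g v ≤ N ↔ v ∈ N := by
  rw [cyclic, LieSubmodule.lieSpan_le, Set.singleton_subset_iff, SetLike.mem_coe]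

lemma cyclic_map (f : V →ₗ⁅ℂ,g⁆ W) (v : V) : cyclic g (f v) = (cyclic g v).map f := by
  apply le_antisymm
  · exact cyclic_le.mpr (LieSubmodule.mem_map_of_mem (self_mem_cyclic v))
  · rw [LieSubmodule.map_le_iff_le_comap, cyclic_le]
    exact self_mem_cyclic (f v)

lemma cyclic_subtype_eq_top (v : V) : cyclic g (⟨v, self_mem_cyclic v⟩ : cyclic g v) = ⊤ := by
  rw [eq_top_iff]
  intro x _
  have hx : (x : V) ∈ (cyclic g (⟨v, self_mem_cyclic v⟩ : cyclic g v)).map (cyclic g v).incl := by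
    rw [← cyclic_map]
    exact x.2
  obtain ⟨y, hy, hyx⟩ := (LieSubmodule.mem_map _).mp hx
  rwa [← Subtype.ext hyx]

lemma lie_lowering {μ : Module.Dual ℂ H} {v : V} (hv : v ∈ hwSpace b V μ) (h : H)
    (I : List (Fin ℓ)) :
    ⁅(h : g), lowering b I v⁆ =
      (μ h - (I.map fun i => b.baseSupp i h).sum) • lowering b I v := by
  induction I with
  | nil => simpa using hv.1 h
  | cons i I ih =>
    rw [lowering_cons, leibniz_lie, lie_f_eq, ih, neg_lie, smul_lie, lie_smul, List.map_cons,
      List.sum_cons, ← neg_smul, ← add_smul]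
    congr 1
    ring

/-- The span of the monomials is stable under the generators of `g`. For `e i`, induct on the word:
commuting past `f j` costs `⁅e i, f j⁆`, which is zero or an element of `H`, and monomials are
weight vectors. -/
lemma cyclic_toSubmodule {μ : Module.Dual ℂ H} {v : V} (hv : v ∈ hwSpace b V μ) :
    (cyclic g v).toSubmodule = Submodule.span ℂ (Set.range fun I => lowering b I v) := by
  set P := Submodule.span ℂ (Set.range fun I => lowering b I v) with hP
  have hmem (I) : lowering b I v ∈ P := Submodule.subset_span ⟨I, rfl⟩
  have hspan (x : g) (hx : ∀ I, ⁅x, lowering b I v⁆ ∈ P) : ∀ p ∈ P, ⁅x, p⁆ ∈ P := by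
    have : P ≤ P.comap (toEnd ℂ g V x) := by
      rw [hP, Submodule.span_le]
      rintro _ ⟨I, rfl⟩
      exact hx I
    exact this
  have hstab (x : g) : ∀ p ∈ P, ⁅x, p⁆ ∈ P := by
    have hx : x ∈ LieSubalgebra.lieSpan ℂ g (Set.range b.e ∪ Set.range b.f) := by
      rw [b.span_ef]; exact LieSubalgebra.mem_top x
    induction hx using LieSubalgebra.lieSpan_induction with
    | mem u hu =>
      refine hspan u ?_
      rcases hu with ⟨i, rfl⟩ | ⟨i, rfl⟩
      · intro I
        induction I with
        | nil =>
          rw [lowering_nil, hv.2]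
          exact P.zero_mem
        | cons j I ih =>
          rw [lowering_cons, leibniz_lie]
          refine P.add_mem ?_ (hspan (b.f j) (fun J => hmem (j :: J)) _ ih)
          rcases eq_or_ne i j with rfl | hij
          · rw [(b.sl2 i).lie_e_f, show b.h i = (b.h' i : g) from rfl, lie_lowering hv]
            exact P.smul_mem _ (hmem I)
          · rw [b.lie_e_f_ne i j hij, zero_lie]
            exact P.zero_mem
      · exact fun I => hmem (i :: I)
    | zero => simp
    | add x y _ _ hx hy =>
      intro p hp
      rw [add_lie]
      exact P.add_mem (hx p hp) (hy p hp)
    | smul c x _ hx =>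
      intro p hp
      rw [smul_lie]
      exact P.smul_mem _ (hx p hp)
    | lie x y _ _ hx hy =>
      intro p hp
      rw [lie_lie]
      exact P.sub_mem (hx _ (hy p hp)) (hy _ (hx p hp))
  apply le_antisymm
  · let N : LieSubmodule ℂ g V := { P with lie_mem := fun {x p} hp => hstab x p hp }
    exact cyclic_le.mpr (show v ∈ N from hmem [])
  · rw [hP, Submodule.span_le]
    rintro _ ⟨I, rfl⟩
    exact lowering_mem _ I (self_mem_cyclic v)

/-- Eigenvectors of a grading element in the submodule generated by a highest weight vector. -/
lemma eigenvalue_of_mem_cyclic {h₀ : H} (hh₀ : ∀ i, b.baseSupp i h₀ = 1)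
    {μ : Module.Dual ℂ H} {v : V} (hv : v ∈ hwSpace b V μ) {x : V} (hx : x ∈ cyclic g v)
    {d : ℂ} (hd : ⁅(h₀ : g), x⁆ = d • x) (hx0 : x ≠ 0) :
    (d = μ h₀ ∧ ∃ c : ℂ, x = c • v) ∨ ∃ n : ℕ, d = μ h₀ - (n + 1) := by
  let E := toEnd ℂ g V (h₀ : g)
  by_cases hn : ∃ n : ℕ, d = μ h₀ - (n + 1)
  · exact Or.inr hn
  refine Or.inl ?_
  have hdis := E.eigenspaces_iSupIndep d
  have hxd : x ∈ E.eigenspace d := Module.End.mem_eigenspace_iff.mpr hd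
  have hvE : v ∈ E.eigenspace (μ h₀) := Module.End.mem_eigenspace_iff.mpr (hv.1 h₀)
  -- The span of the eigenspaces strictly below `μ h₀`. As `d` is none of these eigenvalues, `P`
  -- meets the `d`-eigenspace trivially, while the cyclic module lies in `ℂ v + P`.
  let P : Submodule ℂ V := ⨆ n : ℕ, E.eigenspace (μ h₀ - (n + 1))
  have hPle : P ≤ ⨆ e, ⨆ _ : e ≠ d, E.eigenspace e :=
    iSup_le fun n => le_iSup₂_of_le _ (fun h => hn ⟨n, h.symm⟩) le_rfl
  have hspan : (cyclic g v).toSubmodule ≤ ℂ ∙ v ⊔ P := by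
    rw [cyclic_toSubmodule hv, Submodule.span_le]
    rintro _ ⟨I, rfl⟩
    cases I with
    | nil => exact Submodule.mem_sup_left (Submodule.mem_span_singleton_self v)
    | cons i I =>
      -- The word `i :: I` has length `I.length + 1`, and each letter lowers the eigenvalue by one.
      refine Submodule.mem_sup_right (Submodule.mem_iSup_of_mem I.length ?_)
      rw [Module.End.mem_eigenspace_iff, toEnd_apply_apply, lie_lowering hv]
      simp [hh₀, add_comm]
  obtain ⟨y, hy, p, hp, hyp⟩ := Submodule.mem_sup.mp (hspan hx)
  obtain ⟨c, rfl⟩ := Submodule.mem_span_singleton.mp hy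
  have hcv : c • v ∈ E.eigenspace (μ h₀) := Submodule.smul_mem _ _ hvE
  by_cases hdμ : d = μ h₀
  · refine ⟨hdμ, c, ?_⟩
    have hp' : p ∈ E.eigenspace d := by
      rw [← add_sub_cancel_left (c • v) p, hyp]
      exact Submodule.sub_mem _ hxd (hdμ ▸ hcv)
    have := Submodule.disjoint_def.mp hdis p hp' (hPle hp)
    rw [← hyp, this, add_zero]
  · refine absurd (Submodule.disjoint_def.mp hdis x hxd ?_) hx0
    rw [← hyp]
    exact Submodule.add_mem _ (Submodule.mem_iSup_of_mem (μ h₀)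
      (Submodule.mem_iSup_of_mem (Ne.symm hdμ) hcv)) (hPle hp)

lemma eq_smul_of_mem_hwSpace_of_mem_cyclic {μ : Module.Dual ℂ H} {v x : V}
    (hv : v ∈ hwSpace b V μ) (hxμ : x ∈ hwSpace b V μ) (hx : x ∈ cyclic g v) :
    ∃ c : ℂ, x = c • v := by
  obtain ⟨h₀, hh₀⟩ := exists_grading_element b
  by_cases hx0 : x = 0
  · exact ⟨0, by rw [hx0, zero_smul]⟩
  rcases eigenvalue_of_mem_cyclic hh₀ hv hx (hxμ.1 h₀) hx0 with h | ⟨n, hn⟩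
  · exact h.2
  · have : ((n : ℂ) + 1) = 0 := by linear_combination hn
    exact absurd this (Nat.cast_add_one_ne_zero n)

/-- Neither vector can have a strictly lower `h₀`-eigenvalue than the other, because each lies in
the module generated by the other. Equal eigenvalues force them to be proportional. -/
lemma eq_weight_of_mem_cyclic {μ ν : Module.Dual ℂ H} {v x : V} (hv : v ∈ hwSpace b V μ)
    (hxν : x ∈ hwSpace b V ν) (hx : x ∈ cyclic g v) (hvx : v ∈ cyclic g x) (hx0 : x ≠ 0)
    (hv0 : v ≠ 0) : μ = ν := by
  obtain ⟨h₀, hh₀⟩ := exists_grading_element b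
  have key : ∃ c : ℂ, x = c • v := by
    rcases eigenvalue_of_mem_cyclic hh₀ hv hx (hxν.1 h₀) hx0 with h | ⟨n, hn⟩
    · exact h.2
    · rcases eigenvalue_of_mem_cyclic hh₀ hxν hvx (hv.1 h₀) hv0 with h | ⟨k, hk⟩
      · have : ((n : ℂ) + 1) = 0 := by linear_combination hn + h.1
        exact absurd this (Nat.cast_add_one_ne_zero n)
      · have : (((n + k + 1 : ℕ) : ℂ) + 1) = 0 := by push_cast; linear_combination hn + hk
        exact absurd this (Nat.cast_add_one_ne_zero _)
  obtain ⟨c, rfl⟩ := key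
  ext h
  have h1 := hxν.1 h
  rw [lie_smul, hv.1, smul_comm] at h1
  exact smul_left_injective ℂ hx0 h1

/-- A nonzero finite-dimensional module has a nonzero highest weight vector. -/
lemma exists_isHighestWeight (b : LieAlgebra.Basis (Fin ℓ) H) [FiniteDimensional ℂ V]
    [Nontrivial V] : ∃ μ, IsHighestWeight b V μ := by
  obtain ⟨h₀, hh₀⟩ := exists_grading_element b
  have := b.isLieAbelian_cartan
  let E := toEnd ℂ g V (h₀ : g)
  -- The values at `h₀` of the weights of simultaneous eigenvectors of `H`: finitely many, being
  -- eigenvalues of `h₀`, and at least one by Lie's theorem. Each `e i` raises the value by one, so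
  -- a weight with maximal real part is killed by all `e i`.
  let T : Set ℂ := {c | ∃ μ : Module.Dual ℂ H, ∃ v : V, v ≠ 0 ∧ (∀ h : H, ⁅(h : g), v⁆ = μ h • v) ∧
    μ h₀ = c}
  have hfin : T.Finite := by
    refine (Module.End.finite_hasEigenvalue E).subset ?_
    rintro c ⟨μ, v, hv0, hv, rfl⟩
    exact Module.End.hasEigenvalue_of_hasEigenvector
      ⟨Module.End.mem_eigenspace_iff.mpr (hv h₀), hv0⟩
  have hne : T.Nonempty := by
    obtain ⟨χ, hχ⟩ := exists_nontrivial_weightSpace_of_isSolvable ℂ H V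
    obtain ⟨v, hv⟩ := exists_ne (0 : weightSpace V χ)
    exact ⟨_, χ, v, fun h => hv (Subtype.ext h), (mem_weightSpace χ v.1).mp v.2, rfl⟩
  obtain ⟨_, ⟨μ, v, hv0, hv, rfl⟩, hmax⟩ := T.exists_max_image Complex.re hfin hne
  refine ⟨μ, v, ⟨hv, fun i => ?_⟩, hv0⟩
  by_contra hne
  have := hmax (μ h₀ + 1) ⟨μ + b.baseSupp i, ⁅b.e i, v⁆, hne, fun h => ?_, by simp [hh₀]⟩
  · rw [Complex.add_re, Complex.one_re] at this
    linarith
  · rw [leibniz_lie, lie_e_eq, hv, smul_lie, lie_smul, ← add_smul, add_comm]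
    rfl

lemma exists_hwSpace_of_ne_bot (b : LieAlgebra.Basis (Fin ℓ) H) [FiniteDimensional ℂ V]
    {N : LieSubmodule ℂ g V} (hN : N ≠ ⊥) : ∃ μ, ∃ v ∈ hwSpace b V μ, v ≠ 0 ∧ v ∈ N := by
  have : Nontrivial N := (LieSubmodule.nontrivial_iff_ne_bot ℂ g V).mpr hN
  obtain ⟨μ, v, hv, hv0⟩ := exists_isHighestWeight (V := N) b
  exact ⟨μ, N.incl v, map_mem_hwSpace N.incl hv, fun h => hv0 (Subtype.ext h), v.2⟩

/-- If `v = x + y` with `x` and `y` in independent submodules, then both components of a highest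
weight vector are highest weight vectors of the same weight. -/
lemma mem_hwSpace_of_add {μ : Module.Dual ℂ H} {N C : LieSubmodule ℂ g V} (h : Disjoint N C)
    {x y : V} (hx : x ∈ N) (hy : y ∈ C) (hxy : x + y ∈ hwSpace b V μ) :
    x ∈ hwSpace b V μ ∧ y ∈ hwSpace b V μ := by
  -- The defect of the eigenvector equation for `x` is minus that for `y`, hence lies in both
  -- submodules and vanishes.
  have key (z : g) (c : ℂ) (hz : ⁅z, x + y⁆ = c • (x + y)) :
      ⁅z, x⁆ = c • x ∧ ⁅z, y⁆ = c • y := by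
    have h1 : ⁅z, x⁆ - c • x ∈ N := N.sub_mem (N.lie_mem hx) (N.smul_mem c hx)
    have h2 : c • y - ⁅z, y⁆ ∈ C := C.sub_mem (C.smul_mem c hy) (C.lie_mem hy)
    have h3 : ⁅z, x⁆ - c • x = c • y - ⁅z, y⁆ := by
      rw [lie_add, smul_add] at hz
      rw [sub_eq_sub_iff_add_eq_add, hz, add_comm]
    have h4 : ⁅z, x⁆ - c • x = 0 := by
      rw [← LieSubmodule.disjoint_toSubmodule] at h
      exact Submodule.disjoint_def.mp h _ h1 (h3 ▸ h2)
    exact ⟨sub_eq_zero.mp h4, (sub_eq_zero.mp (h3 ▸ h4)).symm⟩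
  refine ⟨⟨fun t => (key _ _ (hxy.1 t)).1, fun i => ?_⟩, ⟨fun t => (key _ _ (hxy.1 t)).2, fun i => ?_⟩⟩
  · simpa using (key (b.e i) 0 (by rw [hxy.2, zero_smul])).1
  · simpa using (key (b.e i) 0 (by rw [hxy.2, zero_smul])).2

lemma mem_commutant {A : Module.End ℂ V} :
    A ∈ commutant g V ↔ ∀ (x : g) (y : V), A ⁅x, y⁆ = ⁅x, A y⁆ := by
  rw [commutant, Subalgebra.mem_toSubmodule, Subalgebra.mem_centralizer_iff, Set.forall_mem_range]
  refine forall_congr' fun x => ?_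
  rw [LinearMap.ext_iff]
  exact forall_congr' fun y => eq_comm

lemma map_mem_hwSpace_of_mem_commutant {A : Module.End ℂ V} (hA : A ∈ commutant g V)
    {μ : Module.Dual ℂ H} {v : V} (hv : v ∈ hwSpace b V μ) : A v ∈ hwSpace b V μ :=
  map_mem_hwSpace { A with map_lie' := fun {x y} => mem_commutant.mp hA x y } hv

end Basic

/-! ### Irreducibility of modules generated by a highest weight vector -/

section Irreducible

variable {g : Type*} [LieRing g] [LieAlgebra ℂ g] [FiniteDimensional ℂ g] [IsKilling ℂ g]
  {H : LieSubalgebra ℂ g} {ℓ : ℕ} {b : LieAlgebra.Basis (Fin ℓ) H}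
  {V : Type*} [AddCommGroup V] [Module ℂ V] [LieRingModule g V] [LieModule ℂ g V]
  [FiniteDimensional ℂ V]
  {W : Type*} [AddCommGroup W] [Module ℂ W] [LieRingModule g W] [LieModule ℂ g W]

/-- Split `v` along a submodule `N` and a complement. The component in `N` is again a highest weight
vector of weight `μ`, hence a multiple of `v`. So `v` lies in `N` or in the complement, and
whichever contains `v` is everything. -/
lemma isIrreducible_of_cyclic_eq_top {μ : Module.Dual ℂ H} {v : V} (hv : v ∈ hwSpace b V μ)
    (hv0 : v ≠ 0) (htop : cyclic g v = ⊤) : IsIrreducible ℂ g V := by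
  have : Nontrivial V := ⟨v, 0, hv0⟩
  refine IsIrreducible.mk fun N hN => ?_
  have := complementedLattice_of_isKilling ℂ g V
  obtain ⟨C, hC⟩ := exists_isCompl N
  obtain ⟨x, hx, y, hy, hxy⟩ := (LieSubmodule.mem_sup _ _ v).mp
    (hC.sup_eq_top ▸ LieSubmodule.mem_top v)
  obtain ⟨c, hc⟩ := eq_smul_of_mem_hwSpace_of_mem_cyclic hv
    (mem_hwSpace_of_add hC.disjoint hx hy (hxy ▸ hv)).1 (htop ▸ LieSubmodule.mem_top x)
  by_cases hc0 : c = 0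
  · rw [hc0, zero_smul] at hc
    rw [hc, zero_add] at hxy
    have hCtop : C = ⊤ := top_le_iff.mp (htop ▸ cyclic_le.mpr (hxy ▸ hy))
    rw [hCtop] at hC
    exact absurd (disjoint_top.mp hC.disjoint) hN
  · refine top_le_iff.mp (htop ▸ cyclic_le.mpr ?_)
    rw [show v = c⁻¹ • x by rw [hc, smul_smul, inv_mul_cancel₀ hc0, one_smul]]
    exact N.smul_mem _ hx

lemma isIrreducible_cyclic {μ : Module.Dual ℂ H} {v : V} (hv : v ∈ hwSpace b V μ) (hv0 : v ≠ 0) :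
    IsIrreducible ℂ g (cyclic g v) :=
  isIrreducible_of_cyclic_eq_top (b := b) (v := ⟨v, self_mem_cyclic v⟩) (μ := μ)
    (mem_hwSpace_of_map (cyclic g v).incl Subtype.val_injective hv)
    (fun h => hv0 (congrArg Subtype.val h)) (cyclic_subtype_eq_top v)

/-- The form in which irreducibility is used below: a submodule either avoids the cyclic module or
contains its generator. -/
lemma cyclic_le_of_not_disjoint {μ : Module.Dual ℂ H} {v : V} (hv : v ∈ hwSpace b V μ)
    (hv0 : v ≠ 0) {N : LieSubmodule ℂ g V} (hN : ¬ Disjoint (cyclic g v) N) : v ∈ N := by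
  have := isIrreducible_cyclic hv hv0
  rcases eq_bot_or_eq_top (N.comap (cyclic g v).incl) with h | h
  · refine absurd ?_ hN
    rw [← LieSubmodule.disjoint_toSubmodule, Submodule.disjoint_def]
    intro x hx hxN
    have : (⟨x, hx⟩ : cyclic g v) ∈ N.comap (cyclic g v).incl := hxN
    rw [h, LieSubmodule.mem_bot] at this
    exact congrArg Subtype.val this
  · exact (h ▸ LieSubmodule.mem_top _ :
      (⟨v, self_mem_cyclic v⟩ : cyclic g v) ∈ N.comap (cyclic g v).incl)

/-- A module homomorphism not annihilating a highest weight vector `v` restricts to an isomorphism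
from the module generated by `v` to the module generated by its image. -/
lemma exists_equiv_cyclic_map {μ : Module.Dual ℂ H} {v : V} (hv : v ∈ hwSpace b V μ)
    (f : V →ₗ⁅ℂ,g⁆ W) {w : W} (hfw : f v = w) (hf : w ≠ 0) :
    ∃ e : cyclic g v ≃ₗ[ℂ] cyclic g w, ∀ y, (e y : W) = f y := by
  subst hfw
  have hv0 : v ≠ 0 := fun h => hf (by rw [h, map_zero])
  have hmem (y : V) (hy : y ∈ cyclic g v) : f y ∈ cyclic g (f v) := by
    rw [cyclic_map]
    exact LieSubmodule.mem_map_of_mem hy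
  let F : cyclic g v →ₗ[ℂ] cyclic g (f v) :=
    LinearMap.restrict (p := (cyclic g v).toSubmodule) (q := (cyclic g (f v)).toSubmodule)
      (f : V →ₗ[ℂ] W) hmem
  have hF (y) : (F y : W) = f y := rfl
  refine ⟨LinearEquiv.ofBijective F ⟨?_, ?_⟩, hF⟩
  · rw [← LinearMap.ker_eq_bot, LinearMap.ker_eq_bot']
    intro y hy
    have hdisj : Disjoint (cyclic g v) f.ker := by
      by_contra hN
      exact hf (cyclic_le_of_not_disjoint hv hv0 hN)
    rw [← LieSubmodule.disjoint_toSubmodule, Submodule.disjoint_def] at hdisj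
    exact Subtype.ext (hdisj y y.2 (by
      have := hF y
      rw [hy] at this
      exact this.symm))
  · rintro ⟨z, hz⟩
    rw [cyclic_map] at hz
    obtain ⟨y, hy, rfl⟩ := hz
    exact ⟨⟨y, hy⟩, rfl⟩

end Irreducible

/-! ### Products of Lie modules -/

section Prod

variable {R L M N : Type*} [CommRing R] [LieRing L] [LieAlgebra R L]
  [AddCommGroup M] [Module R M] [LieRingModule L M] [LieModule R L M]
  [AddCommGroup N] [Module R N] [LieRingModule L N] [LieModule R L N]

instance prodLieRingModule : LieRingModule L (M × N) where
  bracket x m := (⁅x, m.1⁆, ⁅x, m.2⁆)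
  add_lie _ _ _ := by simp
  lie_add _ _ _ := by simp
  leibniz_lie _ _ _ := by simp

instance prodLieModule : LieModule R L (M × N) where
  smul_lie _ _ _ := Prod.ext (smul_lie _ _ _) (smul_lie _ _ _)
  lie_smul _ _ _ := Prod.ext (lie_smul _ _ _) (lie_smul _ _ _)

variable (R L M N) in
/-- The first projection of a product of Lie modules. -/
def lieModuleFst : M × N →ₗ⁅R,L⁆ M where
  toLinearMap := LinearMap.fst R M N
  map_lie' := rfl

variable (R L M N) in
/-- The second projection of a product of Lie modules. -/
def lieModuleSnd : M × N →ₗ⁅R,L⁆ N where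
  toLinearMap := LinearMap.snd R M N
  map_lie' := rfl

end Prod

/-! ### Uniqueness of the module of given highest weight -/

section Isomorphism

variable {g : Type*} [LieRing g] [LieAlgebra ℂ g] [FiniteDimensional ℂ g] [IsKilling ℂ g]
  {H : LieSubalgebra ℂ g} {ℓ : ℕ} {b : LieAlgebra.Basis (Fin ℓ) H}
  {V : Type*} [AddCommGroup V] [Module ℂ V] [LieRingModule g V] [LieModule ℂ g V]
  [FiniteDimensional ℂ V]
  {W : Type*} [AddCommGroup W] [Module ℂ W] [LieRingModule g W] [LieModule ℂ g W]
  [FiniteDimensional ℂ W]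

/-- Nonzero highest weight vectors of the same weight generate isomorphic modules. -/
lemma exists_equiv_cyclic {μ : Module.Dual ℂ H} {v : V} (hv : v ∈ hwSpace b V μ) (hv0 : v ≠ 0)
    {w : W} (hw : w ∈ hwSpace b W μ) (hw0 : w ≠ 0) :
    ∃ e : cyclic g v ≃ₗ[ℂ] cyclic g w, (∀ (x : g) y, e ⁅x, y⁆ = ⁅x, e y⁆) ∧
      e ⟨v, self_mem_cyclic v⟩ = ⟨w, self_mem_cyclic w⟩ := by
  -- The module generated by `(v, w)` is the graph of the isomorphism sought: both projections
  -- restrict to isomorphisms on it.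
  have hz : (v, w) ∈ hwSpace b (V × W) μ :=
    ⟨fun h => Prod.ext (hv.1 h) (hw.1 h), fun i => Prod.ext (hv.2 i) (hw.2 i)⟩
  obtain ⟨e₁, h₁⟩ := exists_equiv_cyclic_map (w := v) hz (lieModuleFst ℂ g V W) rfl hv0
  obtain ⟨e₂, h₂⟩ := exists_equiv_cyclic_map (w := w) hz (lieModuleSnd ℂ g V W) rfl hw0
  have h₁' (x : g) (y) : e₁ ⁅x, y⁆ = ⁅x, e₁ y⁆ := Subtype.ext (by
    rw [h₁, LieSubmodule.coe_bracket, LieSubmodule.coe_bracket, h₁, LieModuleHom.map_lie])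
  have h₂' (x : g) (y) : e₂ ⁅x, y⁆ = ⁅x, e₂ y⁆ := Subtype.ext (by
    rw [h₂, LieSubmodule.coe_bracket, LieSubmodule.coe_bracket, h₂, LieModuleHom.map_lie])
  have hvv : e₁ ⟨(v, w), self_mem_cyclic _⟩ = ⟨v, self_mem_cyclic v⟩ := Subtype.ext (h₁ _)
  have hww : e₂ ⟨(v, w), self_mem_cyclic _⟩ = ⟨w, self_mem_cyclic w⟩ := Subtype.ext (h₂ _)
  refine ⟨e₁.symm.trans e₂, fun x y => ?_, ?_⟩
  · rw [LinearEquiv.trans_apply, LinearEquiv.trans_apply, ← h₂']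
    congr 1
    exact e₁.injective (by rw [h₁', e₁.apply_symm_apply, e₁.apply_symm_apply])
  · rw [LinearEquiv.trans_apply, ← hww]
    congr 1
    exact e₁.injective (by rw [e₁.apply_symm_apply]; exact hvv.symm)

end Isomorphism

end HighestWeight

namespace HighestWeight

open LieModule LieAlgebra

/-! ### Independence and exhaustion of the cyclic summands -/

section Independence

variable {g : Type*} [LieRing g] [LieAlgebra ℂ g] [FiniteDimensional ℂ g] [IsKilling ℂ g]
  {H : LieSubalgebra ℂ g} {ℓ : ℕ} {b : LieAlgebra.Basis (Fin ℓ) H}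
  {V : Type*} [AddCommGroup V] [Module ℂ V] [LieRingModule g V] [LieModule ℂ g V]
  [FiniteDimensional ℂ V]

/-- Induction on `Q`. A new summand meets the old sum trivially: otherwise its generator would lie
in that sum and, by induction, be a combination of other generators of its own weight, against
`hsep`. So `x` splits into highest weight vectors, and the new component is a multiple of the new
generator. -/
lemma mem_span_of_mem_hwSpace_of_mem_iSup {ι : Type*} {u : ι → V} {wt : ι → Module.Dual ℂ H}
    (hu : ∀ p, u p ∈ hwSpace b V (wt p))
    (hsep : ∀ p, u p ∉ Submodule.span ℂ (u '' {q | q ≠ p ∧ wt q = wt p})) (Q : Finset ι)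
    {ν : Module.Dual ℂ H} {x : V} (hx : x ∈ hwSpace b V ν) (hxQ : x ∈ ⨆ q ∈ Q, cyclic g (u q)) :
    x ∈ Submodule.span ℂ (u '' {q | q ∈ Q ∧ wt q = ν}) := by
  classical
  have hu0 (p) : u p ≠ 0 := fun h => hsep p (h ▸ Submodule.zero_mem _)
  induction Q using Finset.induction_on generalizing ν x with
  | empty =>
    have : x = 0 := by simpa using hxQ
    exact this ▸ Submodule.zero_mem _
  | insert a Q ha ih =>
    rw [Finset.iSup_insert] at hxQ
    have hdisj : Disjoint (cyclic g (u a)) (⨆ q ∈ Q, cyclic g (u q)) := by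
      by_contra hN
      refine hsep a (Submodule.span_mono (Set.image_mono ?_)
        (ih (hu a) (cyclic_le_of_not_disjoint (hu a) (hu0 a) hN)))
      rintro q ⟨hq, hqa⟩
      exact ⟨fun h => ha (h ▸ hq), hqa⟩
    obtain ⟨y, hy, z, hz, rfl⟩ := (LieSubmodule.mem_sup _ _ x).mp hxQ
    obtain ⟨hyν, hzν⟩ := mem_hwSpace_of_add hdisj hy hz hx
    refine Submodule.add_mem _ ?_ (Submodule.span_mono (Set.image_mono ?_) (ih hzν hz))
    · by_cases hy0 : y = 0
      · exact hy0 ▸ Submodule.zero_mem _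
      have hay : u a ∈ cyclic g y := by
        refine cyclic_le_of_not_disjoint (hu a) (hu0 a) fun h => hy0 ?_
        rw [← LieSubmodule.disjoint_toSubmodule] at h
        exact Submodule.disjoint_def.mp h y hy (self_mem_cyclic y)
      have hwt := eq_weight_of_mem_cyclic (hu a) hyν hy hay hy0 (hu0 a)
      obtain ⟨c, rfl⟩ := eq_smul_of_mem_hwSpace_of_mem_cyclic (hu a) (hwt ▸ hyν) hy
      exact Submodule.smul_mem _ _
        (Submodule.subset_span ⟨a, ⟨Finset.mem_insert_self a Q, hwt⟩, rfl⟩)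
    · rintro q ⟨hq, hqν⟩
      exact ⟨Finset.mem_insert_of_mem hq, hqν⟩

lemma iSupIndep_cyclic {ι : Type*} [Finite ι] {u : ι → V} {wt : ι → Module.Dual ℂ H}
    (hu : ∀ p, u p ∈ hwSpace b V (wt p))
    (hsep : ∀ p, u p ∉ Submodule.span ℂ (u '' {q | q ≠ p ∧ wt q = wt p})) :
    iSupIndep fun p => cyclic g (u p) := by
  classical
  have := Fintype.ofFinite ι
  intro p
  by_contra hN
  have hu0 : u p ≠ 0 := fun h => hsep p (h ▸ Submodule.zero_mem _)
  have h := cyclic_le_of_not_disjoint (hu p) hu0 hN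
  refine hsep p (Submodule.span_mono (Set.image_mono ?_)
    (mem_span_of_mem_hwSpace_of_mem_iSup hu hsep (Finset.univ.erase p) (hu p)
      (by simpa [Finset.mem_erase] using h)))
  rintro q ⟨hq, hqp⟩
  exact ⟨Finset.ne_of_mem_erase hq, hqp⟩

/-- A submodule containing all highest weight vectors is the whole module. -/
lemma eq_top_of_hwSpace_le (b : LieAlgebra.Basis (Fin ℓ) H) {U : LieSubmodule ℂ g V}
    (hU : ∀ μ, hwSpace b V μ ≤ U.toSubmodule) : U = ⊤ := by
  have := complementedLattice_of_isKilling ℂ g V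
  obtain ⟨C, hC⟩ := exists_isCompl U
  by_contra hne
  have hCbot : C ≠ ⊥ := fun h => hne (by simpa [h] using hC.sup_eq_top)
  -- A nonzero complement would contain a highest weight vector, which also lies in `U`.
  obtain ⟨μ, x, hx, hx0, hxC⟩ := exists_hwSpace_of_ne_bot b hCbot
  have := hC.disjoint
  rw [← LieSubmodule.disjoint_toSubmodule] at this
  exact hx0 (Submodule.disjoint_def.mp this x (hU μ hx) hxC)

end Independence

/-! ### Monomial bases transported from a model -/

section Monomial

variable {g : Type*} [LieRing g] [LieAlgebra ℂ g] [FiniteDimensional ℂ g] [IsKilling ℂ g]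
  {H : LieSubalgebra ℂ g} {ℓ : ℕ} {b : LieAlgebra.Basis (Fin ℓ) H}
  {V : Type*} [AddCommGroup V] [Module ℂ V] [LieRingModule g V] [LieModule ℂ g V]
  [FiniteDimensional ℂ V]
  {W : Type*} [AddCommGroup W] [Module ℂ W] [LieRingModule g W] [LieModule ℂ g W]
  [FiniteDimensional ℂ W]

lemma exists_equiv_cyclic_lowering {μ : Module.Dual ℂ H} {v : V} (hv : v ∈ hwSpace b V μ)
    (hv0 : v ≠ 0) {w : W} (hw : w ∈ hwSpace b W μ) (hw0 : w ≠ 0) :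
    ∃ e : cyclic g v ≃ₗ[ℂ] cyclic g w, (∀ (x : g) y, e ⁅x, y⁆ = ⁅x, e y⁆) ∧
      ∀ I (y : cyclic g v), (y : V) = lowering b I v → (e y : W) = lowering b I w := by
  obtain ⟨e, he, hvw⟩ := exists_equiv_cyclic hv hv0 hw hw0
  refine ⟨e, he, fun I y hy => ?_⟩
  let f : cyclic g v →ₗ⁅ℂ,g⁆ W :=
    (cyclic g w).incl.comp { e.toLinearMap with map_lie' := fun {x y} => he x y }
  have hy' : y = lowering b I ⟨v, self_mem_cyclic v⟩ := Subtype.ext (by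
    rw [hy]
    exact (map_lowering (cyclic g v).incl I ⟨v, self_mem_cyclic v⟩).symm)
  change f y = _
  rw [hy', map_lowering]
  congr 1
  exact congrArg Subtype.val hvw

/-- `S` is tested on one model only; since the cyclic modules of weight `μ` are isomorphic with
monomials matching, the basis carries over. -/
lemma exists_basis_cyclic {μ : Module.Dual ℂ H} {S : Set (List (Fin ℓ))}
    (hS : IsMonomialIndexSet.{u} b μ S) {v : V} (hv : v ∈ hwSpace b V μ) (hv0 : v ≠ 0) :
    ∃ B : Module.Basis S ℂ (cyclic g v).toSubmodule, ∀ I, (B I : V) = lowering b I.1 v := by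
  obtain ⟨W, _, _, _, _, _, hirr, w, hw, hw0, hli, hspan⟩ := hS
  obtain ⟨e, he, hlow⟩ := exists_equiv_cyclic_lowering hw hw0 hv hv0
  have htop : cyclic g w = ⊤ := (eq_bot_or_eq_top _).resolve_left fun h => hw0 (by
    have := self_mem_cyclic (g := g) w
    rwa [h, LieSubmodule.mem_bot] at this)
  let B₀ : Module.Basis S ℂ W := Module.Basis.mk hli hspan.ge
  let e₀ : W ≃ₗ[ℂ] (cyclic g w).toSubmodule :=
    (LinearEquiv.ofTop _ (by rw [htop]; rfl)).symm
  refine ⟨(B₀.map e₀).map e, fun I => hlow I.1 _ ?_⟩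
  exact Module.Basis.mk_apply hli hspan.ge I

lemma eq_of_mem_cyclic {X : Type*} [AddCommGroup X] [Module ℂ X] {μ : Module.Dual ℂ H}
    {S : Set (List (Fin ℓ))} (hS : IsMonomialIndexSet.{u} b μ S) {v : V}
    (hv : v ∈ hwSpace b V μ) (hv0 : v ≠ 0) (F : cyclic g v →ₗ[ℂ] X) (G : cyclic g v →ₗ[ℂ] X)
    (hFG : ∀ (I : S) (y : cyclic g v), (y : V) = lowering b I.1 v → F y = G y) : F = G := by
  obtain ⟨B, hB⟩ := exists_basis_cyclic hS hv hv0
  exact B.ext fun I => hFG I (B I) (hB I)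

end Monomial

/-! ### The maps `A_j^{s,t}` and the commutant -/

section Transition

variable {g : Type*} [LieRing g] [LieAlgebra ℂ g] [FiniteDimensional ℂ g] [IsKilling ℂ g]
  {H : LieSubalgebra ℂ g} {ℓ : ℕ} {b : LieAlgebra.Basis (Fin ℓ) H}
  {V : Type*} [AddCommGroup V] [Module ℂ V] [LieRingModule g V] [LieModule ℂ g V]
  [FiniteDimensional ℂ V]
  {r : ℕ} {lam : Fin r → Module.Dual ℂ H} {m : Fin r → ℕ} {S : Fin r → Set (List (Fin ℓ))}
  {v : (j : Fin r) → Fin (m j) → V}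
  {B : Module.Basis (Σ p : (Σ j : Fin r, Fin (m j)), S p.1) ℂ V}
  (hS : ∀ j, IsMonomialIndexSet.{u} b (lam j) (S j))
  (hv : ∀ j l, v j l ∈ hwSpace b V (lam j)) (hv0 : ∀ j l, v j l ≠ 0)
  (hB : ∀ j l (I : S j), B ⟨⟨j, l⟩, I⟩ = lowering b I.1 (v j l))

include hS hv hv0 hB

lemma transition_eq_zero {j : Fin r} {s t : Fin (m j)} {p : Σ k : Fin r, Fin (m k)}
    (hp : p ≠ ⟨j, s⟩) {x : V} (hx : x ∈ cyclic g (v p.1 p.2)) : transition b v B j s t x = 0 := by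
  have := eq_of_mem_cyclic (hS p.1) (hv p.1 p.2) (hv0 p.1 p.2)
    (transition b v B j s t ∘ₗ (cyclic g (v p.1 p.2)).incl) 0 (fun I y hy => by
      change transition b v B j s t y = 0
      rw [hy, ← hB, transition, Module.Basis.constr_basis, if_neg hp])
  exact LinearMap.congr_fun this ⟨x, hx⟩

/-- The isomorphism matches all monomials, in particular those indexed by `S j`, where it agrees
with the transition map; these form a basis. This makes the transition map equivariant although its
definition refers only to a basis. -/
lemma exists_transition_eq_equiv (j : Fin r) (s t : Fin (m j)) :
    ∃ e : cyclic g (v j s) ≃ₗ[ℂ] cyclic g (v j t), (∀ (x : g) y, e ⁅x, y⁆ = ⁅x, e y⁆) ∧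
      (e ⟨v j s, self_mem_cyclic _⟩ : V) = v j t ∧
      ∀ y : cyclic g (v j s), transition b v B j s t y = e y := by
  obtain ⟨e, he, hlow⟩ := exists_equiv_cyclic_lowering (hv j s) (hv0 j s) (hv j t) (hv0 j t)
  refine ⟨e, he, hlow [] _ rfl, fun y => ?_⟩
  have := eq_of_mem_cyclic (hS j) (hv j s) (hv0 j s)
    (transition b v B j s t ∘ₗ (cyclic g (v j s)).incl)
    ((cyclic g (v j t)).incl ∘ₗ e.toLinearMap) (fun I y hy => by
      change transition b v B j s t y = e y
      rw [hlow I.1 y hy, hy, ← hB, transition, Module.Basis.constr_basis, if_pos rfl])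
  exact LinearMap.congr_fun this y

lemma bijOn_transition (j : Fin r) (s t : Fin (m j)) :
    Set.BijOn (transition b v B j s t) (cyclic g (v j s)) (cyclic g (v j t)) := by
  obtain ⟨e, -, -, h⟩ := exists_transition_eq_equiv hS hv hv0 hB j s t
  refine ⟨fun x hx => ?_, fun x hx y hy hxy => ?_, fun z hz => ?_⟩
  · rw [h ⟨x, hx⟩]
    exact (e _).2
  · rw [h ⟨x, hx⟩, h ⟨y, hy⟩] at hxy
    exact congrArg Subtype.val (e.injective (Subtype.ext hxy))
  · exact ⟨e.symm ⟨z, hz⟩, (e.symm ⟨z, hz⟩).2, by rw [h, e.apply_symm_apply]⟩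

lemma transition_apply_generator (j : Fin r) (s t : Fin (m j)) :
    transition b v B j s t (v j s) = v j t := by
  obtain ⟨e, -, hvv, h⟩ := exists_transition_eq_equiv hS hv hv0 hB j s t
  rw [← hvv, ← h]

lemma transition_mem_commutant (j : Fin r) (s t : Fin (m j)) :
    transition b v B j s t ∈ commutant g V := by
  obtain ⟨e, he, -, h⟩ := exists_transition_eq_equiv hS hv hv0 hB j s t
  rw [mem_commutant]
  intro x
  suffices transition b v B j s t ∘ₗ toEnd ℂ g V x = toEnd ℂ g V x ∘ₗ transition b v B j s t from
    fun y => LinearMap.congr_fun this y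
  refine B.ext fun ⟨p, I⟩ => ?_
  have hmem : B ⟨p, I⟩ ∈ cyclic g (v p.1 p.2) := by
    rw [hB]
    exact lowering_mem _ _ (self_mem_cyclic _)
  change transition b v B j s t ⁅x, B ⟨p, I⟩⁆ = ⁅x, transition b v B j s t (B ⟨p, I⟩)⁆
  by_cases hp : p = ⟨j, s⟩
  · subst hp
    rw [h ⟨_, hmem⟩, h ⟨_, LieSubmodule.lie_mem _ hmem⟩]
    exact congrArg Subtype.val (he x ⟨_, hmem⟩)
  · rw [transition_eq_zero hS hv hv0 hB hp hmem,
      transition_eq_zero hS hv hv0 hB hp (LieSubmodule.lie_mem _ hmem), lie_zero]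

/-- Evaluation at `v j s` isolates the coefficients with first indices `j, s`. This gives
independence at once and dictates the coefficients in the proof of spanning. -/
lemma sum_smul_transition_apply_generator (a : (Σ j : Fin r, Fin (m j) × Fin (m j)) → ℂ)
    (j : Fin r) (s : Fin (m j)) :
    (∑ q, a q • transition b v B q.1 q.2.1 q.2.2) (v j s) = ∑ t, a ⟨j, (s, t)⟩ • v j t := by
  have hz (k : Fin r) (s' t : Fin (m k)) (hne : (⟨j, s⟩ : Σ k : Fin r, Fin (m k)) ≠ ⟨k, s'⟩) :
      transition b v B k s' t (v j s) = 0 :=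
    transition_eq_zero hS hv hv0 hB hne (self_mem_cyclic (v j s))
  rw [LinearMap.sum_apply, Fintype.sum_sigma, Finset.sum_eq_single j, Fintype.sum_prod_type,
    Finset.sum_eq_single s]
  · refine Finset.sum_congr rfl fun t _ => ?_
    rw [LinearMap.smul_apply, transition_apply_generator hS hv hv0 hB]
  · intro s' _ hs
    refine Finset.sum_eq_zero fun t _ => ?_
    rw [LinearMap.smul_apply, hz _ _ _ fun h => hs (by simpa using h.symm), smul_zero]
  · simp
  · intro k _ hk
    refine Finset.sum_eq_zero fun q _ => ?_
    rw [LinearMap.smul_apply, hz _ _ _ fun h => hk (congrArg Sigma.fst h).symm, smul_zero]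
  · simp

lemma linearIndependent_transition (hv_indep : ∀ j, LinearIndependent ℂ (v j)) :
    LinearIndependent ℂ (fun q : (Σ j : Fin r, Fin (m j) × Fin (m j)) =>
      transition b v B q.1 q.2.1 q.2.2) := by
  rw [Fintype.linearIndependent_iff]
  rintro a ha ⟨j, s, t⟩
  have := sum_smul_transition_apply_generator hS hv hv0 hB a j s
  rw [ha, LinearMap.zero_apply] at this
  exact Fintype.linearIndependent_iff.mp (hv_indep j) _ this.symm t

lemma span_transition
    (hv_span : ∀ j, Submodule.span ℂ (Set.range (v j)) = hwSpace b V (lam j)) :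
    Submodule.span ℂ (Set.range fun q : (Σ j : Fin r, Fin (m j) × Fin (m j)) =>
      transition b v B q.1 q.2.1 q.2.2) = commutant g V := by
  have hle : Submodule.span ℂ (Set.range fun q : (Σ j : Fin r, Fin (m j) × Fin (m j)) =>
      transition b v B q.1 q.2.1 q.2.2) ≤ commutant g V := by
    rw [Submodule.span_le]
    rintro _ ⟨q, rfl⟩
    exact transition_mem_commutant hS hv hv0 hB _ _ _
  refine le_antisymm hle fun A hA => ?_
  -- An equivariant map preserves the highest weight vectors of weight `lam j`, so `A (v j s)` has
  -- coordinates in the `v j t`.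
  have hex (j : Fin r) (s : Fin (m j)) : ∃ c : Fin (m j) → ℂ, ∑ t, c t • v j t = A (v j s) := by
    rw [← Submodule.mem_span_range_iff_exists_fun, hv_span]
    exact map_mem_hwSpace_of_mem_commutant hA (hv j s)
  choose c hc using hex
  let a : (Σ j : Fin r, Fin (m j) × Fin (m j)) → ℂ := fun q => c q.1 q.2.1 q.2.2
  have hmem : ∑ q, a q • transition b v B q.1 q.2.1 q.2.2 ∈
      Submodule.span ℂ (Set.range fun q : (Σ j : Fin r, Fin (m j) × Fin (m j)) =>
        transition b v B q.1 q.2.1 q.2.2) :=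
    Submodule.sum_mem _ fun q _ => Submodule.smul_mem _ _ (Submodule.subset_span ⟨q, rfl⟩)
  suffices A = ∑ q, a q • transition b v B q.1 q.2.1 q.2.2 by rwa [this]
  have hA' := hle hmem
  rw [mem_commutant] at hA hA'
  -- The locus where two equivariant maps agree is a submodule; it contains every generator, hence
  -- every basis monomial.
  let N : LieSubmodule ℂ g V :=
    { LinearMap.eqLocus A (∑ q, a q • transition b v B q.1 q.2.1 q.2.2) with
      lie_mem := by
        intro x y hy
        change A ⁅x, y⁆ = _
        rw [hA, hA', show A y = _ from hy] }
  have hvN (j) (s) : v j s ∈ N := by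
    change A (v j s) = _
    rw [sum_smul_transition_apply_generator hS hv hv0 hB, ← hc]
  refine B.ext fun ⟨⟨j, s⟩, I⟩ => ?_
  rw [hB]
  exact lowering_mem N I.1 (hvN j s)

end Transition

end HighestWeight

/-! ### Assembly of the theorem -/

theorem mainTheorem6
    {g : Type*} [LieRing g] [LieAlgebra ℂ g] [FiniteDimensional ℂ g] [LieAlgebra.IsSemisimple ℂ g]
    {H : LieSubalgebra ℂ g} {ℓ : ℕ} (b : LieAlgebra.Basis (Fin ℓ) H)
    {V : Type u} [AddCommGroup V] [Module ℂ V] [LieRingModule g V] [LieModule ℂ g V]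
    [FiniteDimensional ℂ V]
    {r : ℕ} (lam : Fin r → Module.Dual ℂ H) (hlam_inj : Function.Injective lam)
    (hlam : Set.range lam = {μ | HighestWeight.IsHighestWeight b V μ})
    {m : Fin r → ℕ} (v : (j : Fin r) → Fin (m j) → V)
    (hv_indep : ∀ j, LinearIndependent ℂ (v j))
    (hv_span : ∀ j, Submodule.span ℂ (Set.range (v j)) = HighestWeight.hwSpace b V (lam j))
    (S : Fin r → Set (List (Fin ℓ)))
    (hS : ∀ j, HighestWeight.IsMonomialIndexSet.{u} b (lam j) (S j)) :
    (∀ j l, LieModule.IsIrreducible ℂ g (HighestWeight.cyclic g (v j l))) ∧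
    DirectSum.IsInternal (fun p : (Σ j : Fin r, Fin (m j)) =>
      (HighestWeight.cyclic g (v p.1 p.2)).toSubmodule) ∧
    ∃ B : Module.Basis (Σ p : (Σ j : Fin r, Fin (m j)), S p.1) ℂ V,
      (∀ j l (I : S j), B ⟨⟨j, l⟩, I⟩ = HighestWeight.lowering b I.1 (v j l)) ∧
      (∀ j s t, Set.BijOn (HighestWeight.transition b v B j s t)
        (HighestWeight.cyclic g (v j s)) (HighestWeight.cyclic g (v j t))) ∧
      (∀ j s t (p : Σ k : Fin r, Fin (m k)), p ≠ ⟨j, s⟩ →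
        ∀ x ∈ HighestWeight.cyclic g (v p.1 p.2), HighestWeight.transition b v B j s t x = 0) ∧
      LinearIndependent ℂ (fun q : (Σ j : Fin r, Fin (m j) × Fin (m j)) =>
        HighestWeight.transition b v B q.1 q.2.1 q.2.2) ∧
      Submodule.span ℂ (Set.range fun q : (Σ j : Fin r, Fin (m j) × Fin (m j)) =>
        HighestWeight.transition b v B q.1 q.2.1 q.2.2) = HighestWeight.commutant g V := by
  open HighestWeight in
  have hv (j) (l) : v j l ∈ hwSpace b V (lam j) :=
    hv_span j ▸ Submodule.subset_span (Set.mem_range_self l)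
  have hv0 (j) (l) : v j l ≠ 0 := (hv_indep j).ne_zero l
  -- Injectivity of `lam` means that only vectors with the same `j` share a weight, so independence
  -- of each `v j` suffices.
  have hsep (p : Σ j : Fin r, Fin (m j)) : v p.1 p.2 ∉ Submodule.span ℂ
      ((fun q : Σ j : Fin r, Fin (m j) => v q.1 q.2) '' {q | q ≠ p ∧ lam q.1 = lam p.1}) := by
    obtain ⟨j, l⟩ := p
    refine fun h => (hv_indep j).notMem_span_image (s := {k | k ≠ l}) (x := l) (by simp)
      (Submodule.span_mono ?_ h)
    rintro _ ⟨⟨k, u⟩, ⟨hne, hk⟩, rfl⟩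
    obtain rfl := hlam_inj hk
    exact ⟨u, fun h => hne (by rw [h]), rfl⟩
  have hind : iSupIndep fun p : (Σ j : Fin r, Fin (m j)) => cyclic g (v p.1 p.2) :=
    iSupIndep_cyclic (b := b) (fun p => hv p.1 p.2) hsep
  have htop : ⨆ p : (Σ j : Fin r, Fin (m j)), cyclic g (v p.1 p.2) = ⊤ := by
    refine eq_top_of_hwSpace_le b fun μ x hx => ?_
    by_cases hx0 : x = 0
    · exact hx0 ▸ Submodule.zero_mem _
    obtain ⟨j, rfl⟩ : μ ∈ Set.range lam := hlam ▸ ⟨x, hx, hx0⟩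
    rw [← hv_span] at hx
    refine Submodule.span_le.mpr ?_ hx
    rintro _ ⟨l, rfl⟩
    exact LieSubmodule.mem_iSup_of_mem ⟨j, l⟩ (self_mem_cyclic _)
  have hint : DirectSum.IsInternal (fun p : (Σ j : Fin r, Fin (m j)) =>
      (cyclic g (v p.1 p.2)).toSubmodule) := by
    rw [DirectSum.isInternal_submodule_iff_iSupIndep_and_iSup_eq_top]
    exact ⟨LieSubmodule.iSupIndep_toSubmodule.mpr hind, by
      rw [← LieSubmodule.iSup_toSubmodule, htop, LieSubmodule.top_toSubmodule]⟩
  choose B₀ hB₀ using fun p : (Σ j : Fin r, Fin (m j)) =>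
    exists_basis_cyclic (hS p.1) (hv p.1 p.2) (hv0 p.1 p.2)
  have hB (j) (l) (I : S j) :
      hint.collectedBasis B₀ ⟨⟨j, l⟩, I⟩ = lowering b I.1 (v j l) := by
    rw [DirectSum.IsInternal.collectedBasis_coe]
    exact hB₀ ⟨j, l⟩ I
  exact ⟨fun j l => isIrreducible_cyclic (hv j l) (hv0 j l), hint, hint.collectedBasis B₀, hB,
    bijOn_transition hS hv hv0 hB,
    fun j s t p hp x hx => transition_eq_zero hS hv hv0 hB hp hx,
    linearIndependent_transition hS hv hv0 hB hv_indep,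
    span_transition hS hv hv0 hB hv_span⟩
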